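/- Let $\tau$ be a symbol denoting the unobservable action. For a finite set $A$ of action symbols with $\tau\notin A$ put $A_\tau = A\cup\{\tau\}$. An $A_\tau$-labelled transition system is a quadruple $T=(S,\to,\uparrow,\downarrow)$ with a set of states $S$, a transition relation $\to\ \subseteq S\times A_\tau\times S$, an initial state $\uparrow\ \in S$ and a set of final states $\downarrow\ \subseteq S$. (It need not be finitely branching.) It is *effective* if there are injective codings $S\to\mathbb N$ and $A_\tau\to\mathbb N$ under which the sets $\to$ and $\downarrow$ become recursively enumerable. Write $\twoheadrightarrow$ for the reflexive-transitive closure of $\xrightarrow{\tau}$, and $s\xrightarrow{(a)}t$ if $s\xrightarrow{a}t$, or $a=\tau$ and $s=t$. A *branching bisimulation* from $T_1$ to $T_2$ is a relation $R\subseteq S_1\times S_2$ such that $s_1\mathrel R s_2$ implies: (1) if $s_1\xrightarrow{a}s_1'$, then there are $s_2'',s_2'$ with $s_2\twoheadrightarrow s_2''\xrightarrow{(a)}s_2'$, $s_1\mathrel R s_2''$ and $s_1'\mathrel R s_2'$; (2) if $s_2\xrightarrow{a}s_2'$, then there are $s_1'',s_1'$ with $s_1\twoheadrightarrow s_1''\xrightarrow{(a)}s_1'$,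 $s_1''\mathrel R s_2$ and $s_1'\mathrel R s_2'$; (3) if $s_1$ is final, then there is a final $s_2'$ with $s_2\twoheadrightarrow s_2'$ and $s_1\mathrel R s_2'$; (4) if $s_2$ is final, then there is a final $s_1'$ with $s_1\twoheadrightarrow s_1'$ and $s_1'\mathrel R s_2$. $T_1$ and $T_2$ are *branching bisimilar* if some branching bisimulation from $T_1$ to $T_2$ relates their initial states. Let $D$ be a finite set of data symbols and $D_\square=D\cup\{\square\}$ with a blank $\square\notin D$. A *reactive Turing machine* (RTM) over $A$ and $D$ consists of a finite set $Q$ of states, a transition relation contained in $Q\times D_\square\times A_\tau\times D_\square\times\{L,R\}\times Q$, an initial state in $Q$ and a set of final states contained in $Q$. Its associated transition system has as states the configurations, i.e. pairs of a state in $Q$ and a two-way infinite tape over $D_\square$ with a head position and with all but finitely many cells blank (tapes are taken relative to the head position). A configuration with state $q$ in which the head reads $d$ has an $a$-labelled transition to the configuration obtained by replacing $d$ by $e$, moving the head one cell in direction $M$ and passing to state $q'$, for each transition $(q,d,a,e,M,q')$ of the RTM, and no others. The initial configuration consists of the initial state and the blank tape; a configuration is final if its state is. **Theorem.** There is a finite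 set $D$ of data symbols such that for every finite set $A$ of action symbols and every effective $A_\tau$-labelled transition system $T$ there is an RTM over $A$ and $D$ whose associated transition system is branching bisimilar to $T$. -/

import Mathlib

namespace ReactiveTM

/-- An `Act ∪ {τ}`-labelled transition system with set of states `S`.
Labels are elements of `Option Act`; `none` is the unobservable action `τ`. -/
structure LTS (Act : Type*) (S : Type*) where
  trans : S → Option Act → S → Prop
  init : S
  final : Set S

namespace LTS

variable {Act S S₁ S₂ : Type*}

/-- The reflexive-transitive closure of the `τ`-labelled transitions. -/
def TauSteps (T : LTS Act S) : S → S → Prop :=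
  Relation.ReflTransGen fun s t => T.trans s none t

/-- An `a`-labelled transition, or nothing at all in case `a = τ`. -/
def OptStep (T : LTS Act S) (s : S) (a : Option Act) (t : S) : Prop :=
  T.trans s a t ∨ (a = none ∧ s = t)

/-- Branching bisimulations from `T₁` to `T₂`. -/
structure IsBranchingBisimulation (T₁ : LTS Act S₁) (T₂ : LTS Act S₂)
    (R : S₁ → S₂ → Prop) : Prop where
  forth : ∀ s₁ s₂, R s₁ s₂ → ∀ a s₁', T₁.trans s₁ a s₁' →
    ∃ s₂'' s₂', T₂.TauSteps s₂ s₂'' ∧ T₂.OptStep s₂'' a s₂' ∧ R s₁ s₂'' ∧ R s₁' s₂'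
  back : ∀ s₁ s₂, R s₁ s₂ → ∀ a s₂', T₂.trans s₂ a s₂' →
    ∃ s₁'' s₁', T₁.TauSteps s₁ s₁'' ∧ T₁.OptStep s₁'' a s₁' ∧ R s₁'' s₂ ∧ R s₁' s₂'
  final_forth : ∀ s₁ s₂, R s₁ s₂ → s₁ ∈ T₁.final →
    ∃ s₂', T₂.TauSteps s₂ s₂' ∧ R s₁ s₂' ∧ s₂' ∈ T₂.final
  final_back : ∀ s₁ s₂, R s₁ s₂ → s₂ ∈ T₂.final →
    ∃ s₁', T₁.TauSteps s₁ s₁' ∧ R s₁' s₂ ∧ s₁' ∈ T₁.final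

/-- Two transition systems are branching bisimilar if some branching bisimulation
relates their initial states. -/
def BranchingBisimilar (T₁ : LTS Act S₁) (T₂ : LTS Act S₂) : Prop :=
  ∃ R : S₁ → S₂ → Prop, IsBranchingBisimulation T₁ T₂ R ∧ R T₁.init T₂.init

/-- A transition system is effective if, for some codings of labels and states as natural
numbers (arbitrary injections), the set of its transitions and the set of its final states
are recursively enumerable. -/
def Effective (T : LTS Act S) : Prop :=
  ∃ (codeAct : Option Act → ℕ) (codeState : S → ℕ),
    Function.Injective codeAct ∧ Function.Injective codeState ∧
    REPred (fun p : ℕ × ℕ × ℕ =>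
      ∃ s a t, T.trans s a t ∧ p = (codeState s, codeAct a, codeState t)) ∧
    REPred (fun n : ℕ => ∃ s ∈ T.final, n = codeState s)

end LTS

/-- A reactive Turing machine with action symbols `Act` and data symbols `D`.
Tape symbols are elements of `Option D`; `none` is the blank. The proposition
`trans s d a e m t` says that in state `s`, reading `d`, the machine may execute `a`,
write `e`, move the head in direction `m`, and end up in state `t`. -/
structure RTM (Act : Type*) (D : Type*) where
  State : Type
  finite_state : Finite State
  trans : State → Option D → Option Act → Option D → Turing.Dir → State → Prop
  init : State
  final : Set State

/-- A configuration: a state and a two-way infinite tape with a head position, all but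
finitely many cells of which are blank. -/
abbrev RTM.Config {Act D : Type*} (M : RTM Act D) : Type _ :=
  M.State × Turing.Tape (Option D)

/-- The transition system associated with a reactive Turing machine. Initially, the tape is
blank; a configuration is final if its state is. -/
def RTM.lts {Act D : Type*} (M : RTM Act D) : LTS Act M.Config where
  trans c a c' := ∃ e m, M.trans c.1 c.2.head a e m c'.1 ∧ c'.2 = (c.2.write e).move m
  init := (M.init, Turing.Tape.mk₁ [])
  final := {c | c.1 ∈ M.final}

end ReactiveTM

/-!
A state `s` of the given transition system is simulated by keeping its code in memory together with
a candidate, a number suggesting the code of a target state and a witness. The simulating machine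
may always go on silently to check the next candidate, choosing what it should prove: that `s` has
a transition with a certain label, or that `s` is final. If the check succeeds, the machine may
execute the transition. Until it does so, the memory codes `s`, and every provable fact has
arbitrarily large candidates, so that nothing is ever missed: the silent transitions stay within the
bisimilarity class of `s`, even if `s` has infinitely many transitions.

The checks are computed deterministically, so the silent transitions they consist of are inert as
well. A fixed alphabet suffices because they can be performed by a stack machine whose stacks and
stack symbols do not depend on the function to be computed.
-/

namespace ReactiveTM

open Turing Relation

section BranchingBisimulation

namespace LTS

variable {Act S₁ S₂ S₃ : Type*} {T₁ : LTS Act S₁} {T₂ : LTS Act S₂} {T₃ : LTS Act S₃}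
  {R : S₁ → S₂ → Prop} {R' : S₂ → S₃ → Prop}

theorem IsBranchingBisimulation.symm (h : IsBranchingBisimulation T₁ T₂ R) :
    IsBranchingBisimulation T₂ T₁ (flip R) where
  forth s₂ s₁ hR a s₂' hs := by
    obtain ⟨s₁'', s₁', hτ, ha, h₁, h₂⟩ := h.back s₁ s₂ hR a s₂' hs
    exact ⟨s₁'', s₁', hτ, ha, h₁, h₂⟩
  back s₂ s₁ hR a s₁' hs := by
    obtain ⟨s₂'', s₂', hτ, ha, h₁, h₂⟩ := h.forth s₁ s₂ hR a s₁' hs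
    exact ⟨s₂'', s₂', hτ, ha, h₁, h₂⟩
  final_forth s₂ s₁ hR hs := h.final_back s₁ s₂ hR hs
  final_back s₂ s₁ hR hs := h.final_forth s₁ s₂ hR hs

theorem TauSteps.trans_optStep {s s' s'' : S₁} (hs : T₁.TauSteps s s')
    (hs' : T₁.OptStep s' none s'') : T₁.TauSteps s s'' := by
  rcases hs' with hs' | ⟨-, rfl⟩
  · exact hs.tail hs'
  · exact hs

theorem IsBranchingBisimulation.exists_tauSteps (h : IsBranchingBisimulation T₁ T₂ R)
    {s₁ s₁' : S₁} {s₂ : S₂} (hR : R s₁ s₂) (hs : T₁.TauSteps s₁ s₁') :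
    ∃ s₂', T₂.TauSteps s₂ s₂' ∧ R s₁' s₂' := by
  induction hs with
  | refl => exact ⟨s₂, .refl, hR⟩
  | tail _ hstep ih =>
    obtain ⟨s₂', hs₂, hR'⟩ := ih
    obtain ⟨t, t', ht, ht', -, hR''⟩ := h.forth _ _ hR' none _ hstep
    exact ⟨t', hs₂.trans (ht.trans_optStep ht'), hR''⟩

private theorem IsBranchingBisimulation.forth_comp (h : IsBranchingBisimulation T₁ T₂ R)
    (h' : IsBranchingBisimulation T₂ T₃ R') {s₁ s₁' : S₁} {s₃ : S₃} {a : Option Act}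
    (hR : Comp R R' s₁ s₃) (hs : T₁.trans s₁ a s₁') :
    ∃ s₃'' s₃', T₃.TauSteps s₃ s₃'' ∧ T₃.OptStep s₃'' a s₃' ∧
      Comp R R' s₁ s₃'' ∧ Comp R R' s₁' s₃' := by
  obtain ⟨s₂, hR₁, hR₂⟩ := hR
  obtain ⟨s₂'', s₂', hτ, hstep | ⟨rfl, rfl⟩, h₁, h₁'⟩ := h.forth s₁ s₂ hR₁ a s₁' hs
  · obtain ⟨u, hu, hRu⟩ := h'.exists_tauSteps hR₂ hτ
    obtain ⟨v, v', hv, hv', h₂, h₂'⟩ := h'.forth _ _ hRu a s₂' hstep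
    exact ⟨v, v', hu.trans hv, hv', ⟨s₂'', h₁, h₂⟩, ⟨s₂', h₁', h₂'⟩⟩
  · obtain ⟨u, hu, hRu⟩ := h'.exists_tauSteps hR₂ hτ
    exact ⟨u, u, hu, .inr ⟨rfl, rfl⟩, ⟨s₂'', h₁, hRu⟩, ⟨s₂'', h₁', hRu⟩⟩

private theorem IsBranchingBisimulation.final_forth_comp (h : IsBranchingBisimulation T₁ T₂ R)
    (h' : IsBranchingBisimulation T₂ T₃ R') {s₁ : S₁} {s₃ : S₃}
    (hR : Comp R R' s₁ s₃) (hs : s₁ ∈ T₁.final) :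
    ∃ s₃', T₃.TauSteps s₃ s₃' ∧ Comp R R' s₁ s₃' ∧ s₃' ∈ T₃.final := by
  obtain ⟨s₂, hR₁, hR₂⟩ := hR
  obtain ⟨s₂', hτ, h₁, hs₂'⟩ := h.final_forth s₁ s₂ hR₁ hs
  obtain ⟨u, hu, hRu⟩ := h'.exists_tauSteps hR₂ hτ
  obtain ⟨v, hv, h₂, hvfinal⟩ := h'.final_forth _ _ hRu hs₂'
  exact ⟨v, hu.trans hv, ⟨s₂', h₁, h₂⟩, hvfinal⟩

/- As in the semi-branching bisimulations of Basten, a `τ`-transition may be matched by a nonempty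
path of `τ`-transitions at the end of which nothing is executed. Without this liberty, branching
bisimulations do not compose. -/
theorem IsBranchingBisimulation.comp (h : IsBranchingBisimulation T₁ T₂ R)
    (h' : IsBranchingBisimulation T₂ T₃ R') : IsBranchingBisimulation T₁ T₃ (Comp R R') where
  forth _ _ hR _ _ hs := h.forth_comp h' hR hs
  back _ _ hR _ _ hs := by
    obtain ⟨s₂, hR₁, hR₂⟩ := hR
    simpa only [← flip_comp, flip] using h'.symm.forth_comp h.symm ⟨s₂, hR₂, hR₁⟩ hs
  final_forth _ _ hR hs := h.final_forth_comp h' hR hs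
  final_back _ _ hR hs := by
    obtain ⟨s₂, hR₁, hR₂⟩ := hR
    simpa only [← flip_comp, flip] using h'.symm.final_forth_comp h.symm ⟨s₂, hR₂, hR₁⟩ hs

theorem BranchingBisimilar.trans (h : T₁.BranchingBisimilar T₂)
    (h' : T₂.BranchingBisimilar T₃) : T₁.BranchingBisimilar T₃ := by
  obtain ⟨R, hR, hinit⟩ := h
  obtain ⟨R', hR', hinit'⟩ := h'
  exact ⟨Comp R R', hR.comp hR', T₂.init, hinit, hinit'⟩

theorem IsBranchingBisimulation.of_inert_or_step
    (forth : ∀ s₁ s₂, R s₁ s₂ → ∀ a s₁', T₁.trans s₁ a s₁' →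
      ∃ s₂'' s₂', T₂.TauSteps s₂ s₂'' ∧ T₂.trans s₂'' a s₂' ∧ R s₁ s₂'' ∧ R s₁' s₂')
    (back : ∀ s₁ s₂, R s₁ s₂ → ∀ a s₂', T₂.trans s₂ a s₂' →
      a = none ∧ R s₁ s₂' ∨ ∃ s₁', T₁.trans s₁ a s₁' ∧ R s₁' s₂')
    (final_forth : ∀ s₁ s₂, R s₁ s₂ → s₁ ∈ T₁.final →
      ∃ s₂', T₂.TauSteps s₂ s₂' ∧ R s₁ s₂' ∧ s₂' ∈ T₂.final)
    (final_back : ∀ s₁ s₂, R s₁ s₂ → s₂ ∈ T₂.final → s₁ ∈ T₁.final) :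
    IsBranchingBisimulation T₁ T₂ R where
  forth s₁ s₂ hR a s₁' hs := by
    obtain ⟨s₂'', s₂', hτ, hstep, h₁, h₂⟩ := forth s₁ s₂ hR a s₁' hs
    exact ⟨s₂'', s₂', hτ, .inl hstep, h₁, h₂⟩
  back s₁ s₂ hR a s₂' hs := by
    rcases back s₁ s₂ hR a s₂' hs with ⟨rfl, h⟩ | ⟨s₁', hs₁, h⟩
    · exact ⟨s₁, s₁, .refl, .inr ⟨rfl, rfl⟩, hR, h⟩
    · exact ⟨s₁, s₁', .refl, .inl hs₁, hR, h⟩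
  final_forth := final_forth
  final_back s₁ s₂ hR hs := ⟨s₁, .refl, hR, final_back s₁ s₂ hR hs⟩

end LTS

end BranchingBisimulation

section PostRTM

variable {Act Γ : Type*} [Inhabited Γ]

/-- The tape after the execution of a statement. -/
def execStmt : TM0.Stmt Γ → Tape Γ → Tape Γ
  | .move m, T => T.move m
  | .write x, T => T.write x

/-- A reactive Turing machine in the style of Post: a transition either moves the head or writes a
symbol, but not both. The blank is the default symbol of the alphabet `Γ`. -/
structure PostRTM (Act Γ : Type*) where
  State : Type
  finite_state : Finite State
  trans : State → Γ → Option Act → TM0.Stmt Γ → State → Prop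
  init : State
  final : Set State

namespace PostRTM

/-- The transition system of a machine in the style of Post, started on the blank tape. -/
def lts (M : PostRTM Act Γ) : LTS Act (M.State × Tape Γ) where
  trans c a c' := ∃ s, M.trans c.1 c.2.head a s c'.1 ∧ c'.2 = execStmt s c.2
  init := (M.init, Tape.mk₁ [])
  final := {c | c.1 ∈ M.final}

open Classical in
/-- The symbols of `Γ` as blank or nonblank symbols. -/
noncomputable def cell : Γ ≃ Option {x : Γ // x ≠ default} :=
  (Equiv.optionSubtypeNe default).symm

/-- `cell` as a map preserving the blank, which is what tapes are mapped along. -/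
noncomputable def cellMap : PointedMap Γ (Option {x : Γ // x ≠ default}) :=
  ⟨cell, by classical exact Equiv.optionSubtypeNe_symm_self default⟩

/-- The transitions of `PostRTM.toRTM`. As a reactive Turing machine has to move its head in every
transition, it moves to the right upon writing, and raises a flag that makes it move back. -/
inductive RTMTrans (M : PostRTM Act Γ) : Bool × M.State → Option {x : Γ // x ≠ default} →
    Option Act → Option {x : Γ // x ≠ default} → Dir → Bool × M.State → Prop
  | move {q d a m q'} : M.trans q d a (.move m) q' →
      RTMTrans M (false, q) (cell d) a (cell d) m (false, q')
  | write {q d a x q'} : M.trans q d a (.write x) q' →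
      RTMTrans M (false, q) (cell d) a (cell x) .right (true, q')
  | back {q d} : RTMTrans M (true, q) d none d .left (false, q)

/-- The reactive Turing machine simulating a machine in the style of Post. -/
def toRTM (M : PostRTM Act Γ) : RTM Act {x : Γ // x ≠ default} where
  State := Bool × M.State
  finite_state := have := M.finite_state; inferInstance
  trans := M.RTMTrans
  init := (false, M.init)
  final := {q | q.1 = false ∧ q.2 ∈ M.final}

variable {M : PostRTM Act Γ}

/-- The configuration of `M.toRTM` that simulates the configuration `c` of `M`, with the given
value of the flag. -/
noncomputable def config (flag : Bool) (c : M.State × Tape Γ) : M.toRTM.Config :=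
  ((flag, c.1), (if flag then c.2.move .right else c.2).map cellMap)

theorem head_map_cellMap (T : Tape Γ) : (T.map cellMap).head = cell T.head := T.map_fst cellMap

theorem trans_config_true (c : M.State × Tape Γ) :
    M.toRTM.lts.trans (config true c) none (config false c) := by
  refine ⟨_, .left, .back, ?_⟩
  simp only [config, Tape.write_self, ← Tape.map_move]
  simp

theorem tauSteps_config_false (flag : Bool) (c : M.State × Tape Γ) :
    M.toRTM.lts.TauSteps (config flag c) (config false c) := by
  cases flag
  · exact .refl
  · exact .single (trans_config_true c)

theorem exists_trans_config {c c' : M.State × Tape Γ} {a : Option Act} (h : M.lts.trans c a c') :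
    ∃ flag, M.toRTM.lts.trans (config false c) a (config flag c') := by
  obtain ⟨q, T⟩ := c
  obtain ⟨q', T'⟩ := c'
  obtain ⟨m | x, htrans, rfl : T' = _⟩ := h
  · refine ⟨false, cell T.head, m, ?_, ?_⟩
    · exact (head_map_cellMap T).symm ▸ .move htrans
    · rw [← head_map_cellMap]
      simp only [config, execStmt, Tape.write_self, Bool.false_eq_true, if_false, Tape.map_move]
  · refine ⟨true, cell x, .right, ?_, ?_⟩
    · exact (head_map_cellMap T).symm ▸ .write htrans
    · simp [config, execStmt, Tape.map_move, Tape.map_write, cellMap]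

theorem trans_config_true_cases {c : M.State × Tape Γ} {a : Option Act} {d : M.toRTM.Config}
    (h : M.toRTM.lts.trans (config true c) a d) : a = none ∧ d = config false c := by
  obtain ⟨p, U⟩ := d
  obtain ⟨e, m, htrans, rfl : U = _⟩ := h
  obtain _ | _ | _ := htrans
  refine ⟨rfl, ?_⟩
  simp only [config, Tape.write_self, ← Tape.map_move]
  simp

theorem trans_config_false_cases {c : M.State × Tape Γ} {a : Option Act} {d : M.toRTM.Config}
    (h : M.toRTM.lts.trans (config false c) a d) :
    ∃ c' flag, M.lts.trans c a c' ∧ d = config flag c' := by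
  obtain ⟨q, T⟩ := c
  obtain ⟨p, U⟩ := d
  obtain ⟨e, m, htrans, rfl : U = _⟩ := h
  generalize hx : (config false (M := M) (q, T)).2.head = x at htrans
  replace hx : cell T.head = x := (head_map_cellMap T).symm.trans hx
  cases htrans with
  | @move _ d _ _ q' htrans =>
    obtain rfl := cell.injective hx
    refine ⟨(q', T.move m), false, ⟨.move m, htrans, rfl⟩, ?_⟩
    rw [← head_map_cellMap]
    simp only [config, Tape.write_self, Bool.false_eq_true, if_false, Tape.map_move]
  | @write _ d _ x q' htrans =>
    obtain rfl := cell.injective hx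
    refine ⟨(q', T.write x), true, ⟨.write x, htrans, rfl⟩, ?_⟩
    simp [config, Tape.map_move, Tape.map_write, cellMap]

theorem branchingBisimilar_toRTM (M : PostRTM Act Γ) :
    M.lts.BranchingBisimilar M.toRTM.lts := by
  refine ⟨fun c d => ∃ flag, d = config flag c, .of_inert_or_step ?_ ?_ ?_ ?_, false, ?_⟩
  · rintro c _ ⟨flag, rfl⟩ a c' hc
    obtain ⟨flag', hstep⟩ := exists_trans_config hc
    exact ⟨_, _, tauSteps_config_false flag c, hstep, ⟨false, rfl⟩, flag', rfl⟩
  · rintro c _ ⟨_ | _, rfl⟩ a d hd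
    · obtain ⟨c', flag, hstep, rfl⟩ := trans_config_false_cases hd
      exact .inr ⟨c', hstep, flag, rfl⟩
    · obtain ⟨rfl, rfl⟩ := trans_config_true_cases hd
      exact .inl ⟨rfl, false, rfl⟩
  · rintro c _ ⟨flag, rfl⟩ hc
    exact ⟨_, tauSteps_config_false flag c, ⟨false, rfl⟩, rfl, hc⟩
  · rintro c _ ⟨flag, rfl⟩ hd
    exact hd.2
  · exact Prod.ext rfl (Tape.map_mk₁ cellMap []).symm

end PostRTM

end PostRTM

section Evaluator

open StateTransition Turing.PartrecToTM2

theorem exists_code_of_computable {f : ℕ → ℕ} (hf : Computable f) :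
    ∃ c : ToPartrec.Code, ∀ n, c.eval [n] = pure [f n] := by
  obtain ⟨c, hc⟩ := ToPartrec.Code.exists_code (Nat.Partrec'.part_iff₁.2 hf)
  refine ⟨c, fun n => ?_⟩
  rw [show [n] = (n ::ᵥ .nil : List.Vector ℕ 1).1 from rfl, hc]
  exact Part.map_some _ _

theorem exists_code_toNat_cons {f : ℕ → ℕ} {test : ℕ → Bool} (hf : Computable f)
    (ht : Computable test) :
    ∃ c : ToPartrec.Code, ∀ n, c.eval [n] = pure [(test n).toNat, f n] := by
  have htoNat : Computable Bool.toNat := (Primrec.dom_bool _).to_comp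
  obtain ⟨cf, hcf⟩ := exists_code_of_computable hf
  obtain ⟨ct, hct⟩ := exists_code_of_computable (htoNat.comp ht)
  refine ⟨.cons ct cf, fun n => ?_⟩
  simp [ToPartrec.Code.cons_eval, hcf, hct]

theorem exists_reaches_of_eqOn_compl {K Λ σ : Type*} {Γ : K → Type*} [DecidableEq K]
    {M M' : Λ → TM2.Stmt Γ Λ σ} {q₀ : Λ} (hM' : ∀ q ≠ q₀, M' q = M q)
    (hM : ∀ q ≠ q₀, ∀ v S, (TM2.stepAux (M q) v S).l ≠ none) {c d : TM2.Cfg Γ Λ σ}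
    (h : Reaches (TM2.step M) c d) (hc : c.l ≠ none) (hd : d.l = none) :
    ∃ v S, Reaches (TM2.step M') c ⟨some q₀, v, S⟩ ∧
      Reaches (TM2.step M) ⟨some q₀, v, S⟩ d := by
  induction h using ReflTransGen.head_induction_on with
  | refl => exact absurd hd hc
  | @head c e hce hed ih =>
    obtain ⟨_ | q, v, S⟩ := c
    · exact absurd rfl hc
    by_cases hq : q = q₀
    · subst hq
      exact ⟨v, S, .refl, .head hce hed⟩
    · obtain rfl : TM2.stepAux (M q) v S = e := Option.some.inj hce
      obtain ⟨v', S', h₁, h₂⟩ := ih (hM q hq v S)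
      exact ⟨v', S', .head (congrArg some (by rw [hM' q hq])) h₁, h₂⟩

theorem stepAux_tr_ne_none {q : Λ'} (hq : q ≠ .ret .halt) (v : Option PartrecToTM2.Γ')
    (S : K' → List PartrecToTM2.Γ') : (TM2.stepAux (PartrecToTM2.tr q) v S).l ≠ none := by
  rcases q with _ | _ | _ | _ | _ | _ | _ | (_ | _ | _ | _ | _)
  all_goals first
    | exact absurd rfl hq
    | simp only [PartrecToTM2.tr, pop', push', peek', TM2.stepAux]; grind

/-- The stack program `PartrecToTM2.tr` evaluating codes, except that, before halting, it moves the
first entry of the result, provided it is `0` or `1`, from the main stack to the local store. There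
`bit1` stands for `1`, and `cons`, which terminates numerals, stands for `0`. -/
def evalTr : Λ' → Stmt' :=
  Function.update PartrecToTM2.tr (.ret .halt) <|
    .pop .main (fun _ x => x) <| .branch (fun s => s = some .bit1)
      (.pop .main (fun s _ => s) .halt) .halt

theorem evalTr_ret_halt :
    evalTr (.ret .halt) = .pop .main (fun _ x => x) (.branch (fun s => s = some .bit1)
      (.pop .main (fun s _ => s) .halt) .halt) :=
  Function.update_self ..

theorem evalTr_of_ne {q : Λ'} (hq : q ≠ .ret .halt) : evalTr q = PartrecToTM2.tr q :=
  Function.update_of_ne hq ..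

theorem evalTr_reaches {c : ToPartrec.Code} {v : List ℕ} {n : ℕ} {b : Bool}
    (h : c.eval v = pure [b.toNat, n]) :
    Reaches (TM2.step evalTr) (PartrecToTM2.init c v)
      ⟨none, some (if b then .bit1 else .cons), K'.elim (trList [n]) [] [] []⟩ := by
  have hmem : PartrecToTM2.halt [b.toNat, n] ∈
      eval (TM2.step PartrecToTM2.tr) (PartrecToTM2.init c v) := by
    rw [PartrecToTM2.tr_eval, h]
    exact Part.mem_map _ (Part.mem_some _)
  obtain ⟨s, S, hreach, hhalt⟩ := exists_reaches_of_eqOn_compl (M' := evalTr)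
    (fun _ => evalTr_of_ne) (fun _ => stepAux_tr_ne_none)
    (mem_eval.1 hmem).1 (Option.some_ne_none _) rfl
  obtain rfl : S = K'.elim (trList [b.toNat, n]) [] [] [] := by
    rcases hhalt.cases_head with h | ⟨_, ⟨⟩, h⟩
    · cases h
    · rcases h.cases_head with h | ⟨_, h, -⟩ <;> cases h
      rfl
  refine hreach.tail (congrArg some ?_)
  rw [evalTr_ret_halt]
  have trNat_one : trNat 1 = [.bit1] := rfl
  cases b <;> simp [TM2.stepAux, trList, trNat_one]

/-- The alphabet of the evaluating machines: that of the single-tape machine simulating the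
stacks of `evalTr`. -/
abbrev Sym : Type := TM2to1.Γ' K' fun _ => PartrecToTM2.Γ'

instance : Fintype K' :=
  ⟨{.main, .rev, .aux, .stack}, fun k => by cases k <;> decide⟩

instance : Finite Sym :=
  show Finite (Bool × (K' → Option PartrecToTM2.Γ')) from inferInstance

/-- The tape `T` represents the number `n`: it simulates the stacks of `evalTr`, of which the main
one consists of the list `[n]` and the others are empty. -/
def Represents (n : ℕ) (T : Tape Sym) : Prop :=
  ∃ L : ListBlank (K' → Option PartrecToTM2.Γ'),
    (∀ k, L.map (proj k) =
      ListBlank.mk ((K'.elim (trList [n]) [] [] [] k).map some).reverse) ∧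
    T = Tape.mk' ∅ (TM2to1.addBottom L)

/-- The only symbol of the tape representing `0`. -/
def zeroSym : Sym := (true, fun k => (K'.elim [.cons] [] [] [] k).head?)

theorem represents_zero : Represents 0 ((Tape.mk₁ []).write zeroSym) := by
  refine ⟨ListBlank.mk [fun k => (K'.elim [.cons] [] [] [] k).head?], fun k => ?_, rfl⟩
  cases k
  · rfl
  all_goals exact Quotient.sound (.inr ⟨1, rfl⟩)

/-- The single-tape machine simulating `evalTr`. -/
def evalMachine : TM0.Machine Sym (TM1to0.Λ' (TM2to1.tr evalTr)) :=
  TM1to0.tr (TM2to1.tr evalTr)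

/-- The state in which `evalMachine` starts to evaluate the code `c`. -/
def evalStart (c : ToPartrec.Code) : TM1to0.Λ' (TM2to1.tr evalTr) :=
  (some (TM2to1.tr evalTr (.normal (trNormal c .halt))), none)

theorem evalMachine_reaches {c : ToPartrec.Code} {n m : ℕ} {b : Bool}
    (h : c.eval [n] = pure [b.toNat, m]) {T : Tape Sym} (hT : Represents n T) :
    ∃ T', Represents m T' ∧ Reaches (TM0.step evalMachine) ⟨evalStart c, T⟩
      ⟨(none, some (if b then .bit1 else .cons)), T'⟩ := by
  obtain ⟨L, hL, rfl⟩ := hT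
  obtain ⟨_, ⟨L', hL'⟩, hstack⟩ := tr_reaches (TM2to1.tr_respects evalTr)
    (TM2to1.TrCfg.mk (q := some _) (v := none) L hL) (evalTr_reaches h)
  obtain ⟨_, rfl, htape⟩ := tr_reaches (TM1to0.tr_respects _) rfl hstack
  exact ⟨_, ⟨L', hL', rfl⟩, htape⟩

theorem evalMachine_finite_support (c : ToPartrec.Code) :
    ∃ S : Set (TM1to0.Λ' (TM2to1.tr evalTr)), S.Finite ∧ evalStart c ∈ S ∧
      ∀ q d q' s, evalMachine q d = some (q', s) → q ∈ S → q' ∈ S := by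
  let _ : Inhabited Λ' := ⟨trNormal c .halt⟩
  have hsupp : TM2.Supports evalTr (codeSupp c .halt) := by
    refine ⟨(PartrecToTM2.tr_supports c .halt).1, fun q hq => ?_⟩
    by_cases hhalt : q = .ret .halt
    · subst hhalt
      rw [evalTr_ret_halt]
      exact ⟨trivial, trivial⟩
    · rw [evalTr_of_ne hhalt]
      exact (PartrecToTM2.tr_supports c .halt).2 q hq
  obtain ⟨hstart, hstep⟩ := TM1to0.tr_supports _ (TM2to1.tr_supports evalTr hsupp)
  exact ⟨_, Finset.finite_toSet _, hstart, fun q d q' s h => hstep h⟩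

/-- A deterministic finite-state machine on tapes that outputs a bit upon halting. In state `q`,
reading `d`, it may execute `s` and pass to `q'` if `trans q d s q'`; the states in which it halts
are those for which `output` is not `none`. -/
structure Evaluator (Γ : Type*) where
  State : Type
  finite_state : Finite State
  trans : State → Γ → TM0.Stmt Γ → State → Prop
  start : State
  output : State → Option Bool
  trans_unique : ∀ {q d s₁ q₁ s₂ q₂}, trans q d s₁ q₁ → trans q d s₂ q₂ → s₁ = s₂ ∧ q₁ = q₂
  not_trans_of_output : ∀ {q b d s q'}, output q = some b → ¬ trans q d s q'

namespace Evaluator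

/-- One step of an evaluator. -/
def Step {Γ : Type*} [Inhabited Γ] (E : Evaluator Γ) (c c' : E.State × Tape Γ) : Prop :=
  ∃ s, E.trans c.1 c.2.head s c'.1 ∧ c'.2 = execStmt s c.2

/-- From the configuration `c`, the evaluator halts with output `b` on a tape representing `n`. -/
def HaltsWith (E : Evaluator Sym) (c : E.State × Tape Sym) (n : ℕ) (b : Bool) : Prop :=
  ∃ q T, E.output q = some b ∧ Represents n T ∧ ReflTransGen E.Step c (q, T)

variable {E : Evaluator Sym} {c c' : E.State × Tape Sym} {n : ℕ} {b : Bool}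

theorem HaltsWith.of_step (h : E.HaltsWith c n b) (hstep : E.Step c c') :
    E.HaltsWith c' n b := by
  obtain ⟨q, T, hq, hT, hc⟩ := h
  obtain ⟨s, htrans, hs⟩ := hstep
  rcases hc.cases_head with rfl | ⟨c'', ⟨s', htrans', hs'⟩, hc''⟩
  · exact absurd htrans (E.not_trans_of_output hq)
  · obtain ⟨rfl, hstate⟩ := E.trans_unique htrans htrans'
    obtain rfl : c' = c'' := Prod.ext hstate (hs.trans hs'.symm)
    exact ⟨q, T, hq, hT, hc''⟩

theorem HaltsWith.of_output (h : E.HaltsWith c n b) {b' : Bool} (hc : E.output c.1 = some b') :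
    b' = b ∧ Represents n c.2 := by
  obtain ⟨q, T, hq, hT, hreach⟩ := h
  rcases hreach.cases_head with rfl | ⟨_, ⟨s, htrans, -⟩, -⟩
  · exact ⟨Option.some.inj (hc.symm.trans hq), hT⟩
  · exact absurd htrans (E.not_trans_of_output hc)

/-- The evaluator of a code, the states of `evalMachine` being restricted to a finite set. -/
def ofCode (c : ToPartrec.Code) {S : Set (TM1to0.Λ' (TM2to1.tr evalTr))} (hfin : S.Finite)
    (hstart : evalStart c ∈ S) : Evaluator Sym where
  State := S
  finite_state := hfin
  trans q d s q' := evalMachine q.1 d = some (q'.1, s)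
  start := ⟨evalStart c, hstart⟩
  output
    | ⟨(none, x), _⟩ => some (x = some .bit1)
    | ⟨(some _, _), _⟩ => none
  trans_unique h₁ h₂ := by
    have h := Option.some.inj (h₁.symm.trans h₂)
    exact ⟨congrArg Prod.snd h, Subtype.ext (congrArg Prod.fst h)⟩
  not_trans_of_output := by
    rintro ⟨⟨_ | _, x⟩, _⟩ b d s q' h htrans
    · cases htrans
    · cases h

theorem ofCode_reaches {c : ToPartrec.Code} {S : Set (TM1to0.Λ' (TM2to1.tr evalTr))}
    {hfin : S.Finite} {hstart : evalStart c ∈ S}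
    (hS : ∀ q d q' s, evalMachine q d = some (q', s) → q ∈ S → q' ∈ S)
    {x y : TM0.Cfg Sym (TM1to0.Λ' (TM2to1.tr evalTr))}
    (h : Reaches (TM0.step evalMachine) x y) (hx : x.q ∈ S) :
    ∃ hy : y.q ∈ S,
      ReflTransGen (ofCode c hfin hstart).Step (⟨x.q, hx⟩, x.Tape) (⟨y.q, hy⟩, y.Tape) := by
  induction h with
  | refl => exact ⟨hx, .refl⟩
  | @tail y z _ hyz ih =>
    obtain ⟨hy, hreach⟩ := ih
    obtain ⟨⟨q, s⟩, htrans, rfl⟩ := Option.map_eq_some_iff.1 hyz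
    exact ⟨hS _ _ _ _ htrans hy, hreach.tail ⟨s, htrans, by cases s <;> rfl⟩⟩

end Evaluator

theorem exists_evaluator {f : ℕ → ℕ} {test : ℕ → Bool} (hf : Computable f)
    (ht : Computable test) :
    ∃ E : Evaluator Sym, ∀ n T, Represents n T → E.HaltsWith (E.start, T) (f n) (test n) := by
  obtain ⟨c, hc⟩ := exists_code_toNat_cons hf ht
  obtain ⟨S, hfin, hstart, hS⟩ := evalMachine_finite_support c
  refine ⟨.ofCode c hfin hstart, fun n T hT => ?_⟩
  obtain ⟨T', hT', hreach⟩ := evalMachine_reaches (hc n) hT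
  obtain ⟨hmem, hreach'⟩ := Evaluator.ofCode_reaches hS hreach hstart
  have hout : decide (some (if test n then Γ'.bit1 else Γ'.cons) = some .bit1) = test n := by
    cases test n <;> rfl
  exact ⟨⟨_, hmem⟩, T', congrArg some hout, hT', hreach'⟩

end Evaluator

section Flowchart

/-- A program operating on a single natural number. In block `p`, the memory `n` is replaced by
`update p n`, on which `test p` is evaluated; if the outcome is `b` and `jump p b a p'`, then the
program may execute `a` and proceed with `p'`. -/
structure Flowchart (Act : Type*) where
  Block : Type
  finite_block : Finite Block
  update : Block → ℕ → ℕ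
  test : Block → ℕ → Bool
  computable_update : ∀ p, Computable (update p)
  computable_test : ∀ p, Computable (test p)
  jump : Block → Bool → Option Act → Block → Prop
  init : Block
  accept : Set Block

namespace Flowchart

variable {Act : Type*}

/-- The transition system of a flowchart, started with memory `0`. A state consists of the block
to be executed next and the memory before its execution. It is final if the block is accepting and
its test is going to succeed. -/
def lts (F : Flowchart Act) : LTS Act (F.Block × ℕ) where
  trans c a c' := c'.2 = F.update c.1 c.2 ∧ F.jump c.1 (F.test c.1 c'.2) a c'.1
  init := (F.init, 0)
  final := {c | c.1 ∈ F.accept ∧ F.test c.1 (F.update c.1 c.2) = true}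

/-- The transitions of `Flowchart.toPostRTM`. The state `none` only serves to write the
representation of the initial memory. -/
inductive PostTrans (F : Flowchart Act) (E : F.Block → Evaluator Sym) :
    Option (Σ p, (E p).State) → Sym → Option Act → TM0.Stmt Sym →
      Option (Σ p, (E p).State) → Prop
  | boot {d} : PostTrans F E none d none (.write zeroSym) (some ⟨F.init, (E F.init).start⟩)
  | run {p q d s q'} : (E p).trans q d s q' →
      PostTrans F E (some ⟨p, q⟩) d none s (some ⟨p, q'⟩)
  | jump {p q b d a r} : (E p).output q = some b → F.jump p b a r →
      PostTrans F E (some ⟨p, q⟩) d a (.write d) (some ⟨r, (E r).start⟩)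

/-- The machine executing a flowchart by means of evaluators of its blocks. -/
def toPostRTM (F : Flowchart Act) (E : F.Block → Evaluator Sym) : PostRTM Act Sym where
  State := Option (Σ p, (E p).State)
  finite_state := by
    have := F.finite_block
    have := fun p => (E p).finite_state
    infer_instance
  trans := PostTrans F E
  init := none
  final := {x | ∃ p q, x = some ⟨p, q⟩ ∧ p ∈ F.accept ∧ (E p).output q = some true}

/-- The evaluator computes the update of the block `p` and the test of the updated memory. -/
def Implements (F : Flowchart Act) (p : F.Block) (E : Evaluator Sym) : Prop :=
  ∀ n T, Represents n T →
    E.HaltsWith (E.start, T) (F.update p n) (F.test p (F.update p n))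

theorem exists_implements (F : Flowchart Act) (p : F.Block) : ∃ E, F.Implements p E :=
  exists_evaluator (F.computable_update p) ((F.computable_test p).comp (F.computable_update p))

/-- The branching bisimulation between a flowchart and the machine executing it: the configuration
is about to write the initial memory, or to finish the evaluation of the current block. -/
inductive Simulates (F : Flowchart Act) (E : F.Block → Evaluator Sym) :
    F.Block × ℕ → Option (Σ p, (E p).State) × Tape Sym → Prop
  | boot : Simulates F E F.lts.init (F.toPostRTM E).lts.init
  | run {p n q T} : (E p).HaltsWith (q, T) (F.update p n) (F.test p (F.update p n)) →
      Simulates F E (p, n) (some ⟨p, q⟩, T)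

variable {F : Flowchart Act} {E : F.Block → Evaluator Sym} {p : F.Block} {n : ℕ}

theorem tauSteps_of_reflTransGen {c c' : (E p).State × Tape Sym}
    (h : ReflTransGen (E p).Step c c') :
    (F.toPostRTM E).lts.TauSteps (some ⟨p, c.1⟩, c.2) (some ⟨p, c'.1⟩, c'.2) :=
  ReflTransGen.lift (p := fun x y => (F.toPostRTM E).lts.trans x none y)
    (fun c : (E p).State × Tape Sym => (some ⟨p, c.1⟩, c.2))
    (fun _ _ ⟨s, htrans, hs⟩ => ⟨s, .run htrans, hs⟩) _ _ h

theorem trans_init : (F.toPostRTM E).lts.trans (F.toPostRTM E).lts.init none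
    (some ⟨F.init, (E F.init).start⟩, (Tape.mk₁ []).write zeroSym) :=
  ⟨.write zeroSym, .boot, rfl⟩

theorem Simulates.exists_tauSteps_output (hE : ∀ p, F.Implements p (E p))
    {c : Option (Σ p, (E p).State) × Tape Sym} (h : Simulates F E (p, n) c) :
    ∃ q T, (F.toPostRTM E).lts.TauSteps c (some ⟨p, q⟩, T) ∧
      (E p).output q = some (F.test p (F.update p n)) ∧ Represents (F.update p n) T := by
  rcases h with _ | ⟨q, T, hq, hT, hreach⟩
  · obtain ⟨q, T, hq, hT, hreach⟩ := hE F.init 0 _ represents_zero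
    exact ⟨q, T, .head trans_init (tauSteps_of_reflTransGen hreach), hq, hT⟩
  · exact ⟨q, T, tauSteps_of_reflTransGen hreach, hq, hT⟩

theorem Simulates.back (hE : ∀ p, F.Implements p (E p))
    {c c' : Option (Σ p, (E p).State) × Tape Sym} {a : Option Act} (h : Simulates F E (p, n) c)
    (hc : (F.toPostRTM E).lts.trans c a c') :
    a = none ∧ Simulates F E (p, n) c' ∨
      ∃ x, F.lts.trans (p, n) a x ∧ Simulates F E x c' := by
  obtain ⟨x, T'⟩ := c'
  obtain ⟨s, htrans, rfl : T' = _⟩ := hc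
  rcases h with _ | h
  · obtain _ | _ | _ := htrans
    exact .inl ⟨rfl, .run (hE F.init 0 _ represents_zero)⟩
  · rcases htrans with _ | htrans | ⟨hq, hjump⟩
    · exact .inl ⟨rfl, .run (h.of_step ⟨s, htrans, rfl⟩)⟩
    · obtain ⟨rfl, hT⟩ := h.of_output hq
      refine .inr ⟨(_, F.update p n), ⟨rfl, hjump⟩, .run (hE _ _ _ ?_)⟩
      simpa only [execStmt, Tape.write_self] using hT

theorem branchingBisimilar_toPostRTM (hE : ∀ p, F.Implements p (E p)) :
    F.lts.BranchingBisimilar (F.toPostRTM E).lts := by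
  refine ⟨Simulates F E, .of_inert_or_step ?_ ?_ ?_ ?_, .boot⟩
  · rintro ⟨p, n⟩ c h a ⟨p', _⟩ ⟨rfl, hjump⟩
    obtain ⟨q, T, hc, hq, hT⟩ := h.exists_tauSteps_output hE
    exact ⟨_, (some ⟨p', (E p').start⟩, T), hc,
      ⟨.write T.head, .jump hq hjump, (T.write_self).symm⟩,
      .run ⟨q, T, hq, hT, .refl⟩, .run (hE p' _ T hT)⟩
  · rintro ⟨p, n⟩ c h a c' hc
    exact h.back hE hc
  · rintro ⟨p, n⟩ c h ⟨hp, htest⟩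
    obtain ⟨q, T, hc, hq, hT⟩ := h.exists_tauSteps_output hE
    exact ⟨_, hc, .run ⟨q, T, hq, hT, .refl⟩, p, q, rfl, hp, hq.trans (congrArg some htest)⟩
  · rintro _ _ (_ | h) ⟨p, q, ⟨⟩, hp, hq⟩
    exact ⟨hp, (h.of_output hq).1.symm⟩

theorem exists_branchingBisimilar_postRTM (F : Flowchart Act) :
    ∃ M : PostRTM Act Sym, F.lts.BranchingBisimilar M.lts := by
  choose E hE using F.exists_implements
  exact ⟨F.toPostRTM E, branchingBisimilar_toPostRTM hE⟩

end Flowchart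

end Flowchart

section Search

open Filter

theorem exists_primrec_of_rePred {α : Type*} [Primcodable α] {p : α → Prop} (h : REPred p) :
    ∃ f : α → ℕ → Bool, Primrec₂ f ∧ ∀ a, p a ↔ ∃ w, f a w = true := by
  obtain ⟨c, hc⟩ := Nat.Partrec.Code.exists_code.1 h
  refine ⟨fun a w => (Nat.Partrec.Code.evaln w c (Encodable.encode a)).isSome, ?_, fun a => ?_⟩
  · exact Primrec.option_isSome.comp (Nat.Partrec.Code.primrec_evaln.comp
      ((Primrec.snd.pair (Primrec.const c)).pair (Primrec.encode.comp Primrec.fst)))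
  · have hdom : p a ↔ ∃ x, x ∈ c.eval (Encodable.encode a) := by
      rw [hc]
      simp
    simp_rw [hdom, Nat.Partrec.Code.evaln_complete, Option.isSome_iff_exists]
    exact exists_comm

/-- The data needed to search for the transitions and for the finality of the states of `T`. A
candidate `k` suggests the transitions to the state with code `target k`. Whether it proves that
the state with code `n` has such a transition, labelled `a`, is decided by
`test (some (label a)) n k`; whether it proves that the state is final, by `test none n k`.
Provable facts have arbitrarily large proofs. -/
structure Enumeration {Act S : Type*} (T : LTS Act S) where
  Label : Type
  finite_label : Finite Label
  label : Option Act → Label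
  code : S → ℕ
  target : ℕ → ℕ
  test : Option Label → ℕ → ℕ → Bool
  computable_target : Computable target
  computable_test : ∀ l, Computable₂ (test l)
  exists_trans_of_test : ∀ {s a k}, test (some (label a)) (code s) k = true →
    ∃ t, T.trans s a t ∧ target k = code t
  frequently_test_of_trans : ∀ {s a t}, T.trans s a t →
    ∃ᶠ k in atTop, target k = code t ∧ test (some (label a)) (code s) k = true
  mem_final_of_test : ∀ {s k}, test none (code s) k = true → s ∈ T.final
  frequently_test_of_mem_final : ∀ {s}, s ∈ T.final →
    ∃ᶠ k in atTop, test none (code s) k = true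

theorem frequently_unpair_snd_eq (m : ℕ) : ∃ᶠ k in atTop, (Nat.unpair k).2 = m :=
  frequently_atTop.2 fun K =>
    ⟨Nat.pair K m, Nat.left_le_pair K m, congrArg Prod.snd (Nat.unpair_pair K m)⟩

theorem LTS.exists_primrec_trans {Act S : Type*} {T : LTS Act S} {codeAct : Option Act → ℕ}
    {codeState : S → ℕ} (hact : codeAct.Injective) (hstate : codeState.Injective)
    (h : REPred fun p : ℕ × ℕ × ℕ =>
      ∃ s a t, T.trans s a t ∧ p = (codeState s, codeAct a, codeState t)) :
    ∃ f : ℕ × ℕ × ℕ → ℕ → Bool, Primrec₂ f ∧ ∀ {s a n},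
      (∃ t, T.trans s a t ∧ n = codeState t) ↔ ∃ w, f (codeState s, codeAct a, n) w = true := by
  obtain ⟨f, hf, hf'⟩ := exists_primrec_of_rePred h
  refine ⟨f, hf, fun {s a n} => ?_⟩
  rw [← hf']
  constructor
  · rintro ⟨t, ht, rfl⟩
    exact ⟨s, a, t, ht, rfl⟩
  · rintro ⟨s', a', t, ht, heq⟩
    obtain ⟨hs, ha, hn⟩ : codeState s = codeState s' ∧ codeAct a = codeAct a' ∧ _ := by
      simpa only [Prod.mk.injEq] using heq
    exact ⟨t, hstate hs ▸ hact ha ▸ ht, hn⟩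

theorem LTS.exists_primrec_final {Act S : Type*} {T : LTS Act S} {codeState : S → ℕ}
    (hstate : codeState.Injective) (h : REPred fun n : ℕ => ∃ s ∈ T.final, n = codeState s) :
    ∃ g : ℕ → ℕ → Bool, Primrec₂ g ∧
      ∀ {s}, s ∈ T.final ↔ ∃ w, g (codeState s) w = true := by
  obtain ⟨g, hg, hg'⟩ := exists_primrec_of_rePred h
  refine ⟨g, hg, fun {s} => ?_⟩
  rw [← hg']
  constructor
  · exact fun hs => ⟨s, hs, rfl⟩
  · rintro ⟨s', hs', heq⟩
    exact hstate heq ▸ hs'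

theorem LTS.Effective.nonempty_enumeration {Act S : Type*} [Finite Act] {T : LTS Act S}
    (h : T.Effective) : Nonempty (Enumeration T) := by
  obtain ⟨codeAct, codeState, hact, hstate, htrans, hfinal⟩ := h
  obtain ⟨f, hf, trans_iff⟩ := LTS.exists_primrec_trans hact hstate htrans
  obtain ⟨g, hg, final_iff⟩ := LTS.exists_primrec_final hstate hfinal
  have hsnd : Primrec fun k : ℕ => k.unpair.2 := .comp .snd .unpair
  have htarget : Primrec fun k : ℕ => k.unpair.2.unpair.1 := .comp .fst (.comp .unpair hsnd)
  have hwitness : Primrec fun k : ℕ => k.unpair.2.unpair.2 := hsnd.comp hsnd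
  exact ⟨{
    Label := Set.range codeAct
    finite_label := inferInstance
    label a := ⟨codeAct a, Set.mem_range_self a⟩
    code := codeState
    target k := k.unpair.2.unpair.1
    test
      | some i, n, k => f (n, i, k.unpair.2.unpair.1) k.unpair.2.unpair.2
      | none, n, k => g n k.unpair.2.unpair.2
    computable_target := htarget.to_comp
    computable_test := by
      rintro (_ | i)
      · exact (hg.comp .fst (hwitness.comp .snd)).to_comp
      · exact (hf.comp (.pair .fst (.pair (.const _) (htarget.comp .snd)))
          (hwitness.comp .snd)).to_comp
    exists_trans_of_test h := trans_iff.2 ⟨_, h⟩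
    frequently_test_of_trans {s a t} ht := by
      obtain ⟨w, hw⟩ := trans_iff.1 ⟨t, ht, rfl⟩
      refine (frequently_unpair_snd_eq (Nat.pair (codeState t) w)).mono fun k hk => ?_
      simpa only [hk, Nat.unpair_pair, true_and] using hw
    mem_final_of_test h := final_iff.2 ⟨_, h⟩
    frequently_test_of_mem_final hs := by
      obtain ⟨w, hw⟩ := final_iff.1 hs
      refine (frequently_unpair_snd_eq (Nat.pair 0 w)).mono fun k hk => ?_
      simpa only [hk, Nat.unpair_pair] using hw }⟩

/-- The blocks of the search flowchart: initialize the memory, move to the target of the current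
candidate, and check the next candidate for transitions with a given label or for finality. -/
inductive SearchBlock (ι : Type)
  | boot
  | move
  | check (l : Option ι)

instance {ι : Type} [Finite ι] : Finite (SearchBlock ι) :=
  .of_surjective (α := Option (Option (Option ι)))
    (fun
      | none => .boot
      | some none => .move
      | some (some l) => .check l)
    (by
      rintro (_ | _ | l)
      exacts [⟨none, rfl⟩, ⟨some none, rfl⟩, ⟨some (some l), rfl⟩])

namespace Enumeration

variable {Act S : Type*} {T : LTS Act S}

/-- The memory after the execution of a block. The memory consists of the code of a state and a
candidate. -/
def update (E : Enumeration T) : SearchBlock E.Label → ℕ → ℕ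
  | .boot, _ => Nat.pair (E.code T.init) 0
  | .move, m => Nat.pair (E.target m.unpair.2) 0
  | .check _, m => Nat.pair m.unpair.1 (m.unpair.2 + 1)

/-- The test of a block. -/
def blockTest (E : Enumeration T) : SearchBlock E.Label → ℕ → Bool
  | .check l, m => E.test l m.unpair.1 m.unpair.2
  | _, _ => false

/-- The jumps of the search flowchart: one may always go on to check the next candidate for
whatever one likes, and if a candidate proves the existence of a transition, one may execute it. -/
inductive Jump (E : Enumeration T) :
    SearchBlock E.Label → Bool → Option Act → SearchBlock E.Label → Prop
  | check {p b l} : Jump E p b none (.check l)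
  | move {a} : Jump E (.check (some (E.label a))) true a .move

theorem computable_update (E : Enumeration T) (p : SearchBlock E.Label) :
    Computable (E.update p) := by
  have hpair : Computable₂ Nat.pair := Primrec₂.natPair.to_comp
  have hfst : Computable fun m : ℕ => m.unpair.1 := Computable.fst.comp Computable.unpair
  have hsnd : Computable fun m : ℕ => m.unpair.2 := Computable.snd.comp Computable.unpair
  cases p with
  | boot => exact .const _
  | move => exact hpair.comp (E.computable_target.comp hsnd) (.const 0)
  | check l => exact hpair.comp hfst (Computable.succ.comp hsnd)

theorem computable_blockTest (E : Enumeration T) (p : SearchBlock E.Label) :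
    Computable (E.blockTest p) := by
  cases p with
  | boot | move => exact .const false
  | check l =>
    exact (E.computable_test l).comp (Computable.fst.comp Computable.unpair)
      (Computable.snd.comp Computable.unpair)

/-- The flowchart that simulates `T` by searching for transitions. -/
def flowchart (E : Enumeration T) : Flowchart Act where
  Block := SearchBlock E.Label
  finite_block := have := E.finite_label; inferInstance
  update := E.update
  test := E.blockTest
  computable_update := E.computable_update
  computable_test := E.computable_blockTest
  jump := E.Jump
  init := .boot
  accept := {.check none}

/-- A state of the flowchart is related to a state of `T` if its next block is going to leave the
code of the latter in the memory. -/
def Codes (E : Enumeration T) (s : S) (c : SearchBlock E.Label × ℕ) : Prop :=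
  (E.update c.1 c.2).unpair.1 = E.code s

theorem eventually_tauSteps_check (E : Enumeration T) {s : S} {c : SearchBlock E.Label × ℕ}
    (h : E.Codes s c) : ∀ᶠ k in atTop, ∀ l, ∃ m, E.flowchart.lts.TauSteps c (.check l, m) ∧
      E.update (.check l) m = Nat.pair (E.code s) k := by
  have hcheck (c : SearchBlock E.Label × ℕ) (l) :
      E.flowchart.lts.trans c none (.check l, E.update c.1 c.2) := ⟨rfl, .check⟩
  refine eventually_atTop.2 ⟨(E.update c.1 c.2).unpair.2 + 1, fun k hk l => ?_⟩
  induction k, hk using Nat.le_induction with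
  | base => exact ⟨E.update c.1 c.2, .single (hcheck c l), by rw [update, h]⟩
  | succ k _ ih =>
    obtain ⟨m, hm, hupdate⟩ := ih
    refine ⟨_, hm.tail (hcheck _ l), ?_⟩
    simp only [hupdate]
    simp only [update, Nat.unpair_pair]

theorem Codes.of_update_eq {E : Enumeration T} {s : S} {p : SearchBlock E.Label} {m k : ℕ}
    (h : E.update p m = Nat.pair (E.code s) k) : E.Codes s (p, m) := by
  rw [Codes, h, Nat.unpair_pair]

theorem blockTest_of_update_eq {E : Enumeration T} {l : Option E.Label} {m n k : ℕ}
    (h : E.update (.check l) m = Nat.pair n k) (htest : E.test l n k = true) :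
    E.blockTest (.check l) (E.update (.check l) m) = true := by
  simpa only [h, blockTest, Nat.unpair_pair] using htest

theorem Codes.test_of_blockTest {E : Enumeration T} {s : S} {l : Option E.Label} {m : ℕ}
    (h : E.Codes s (.check l, m)) (htest : E.blockTest (.check l) (E.update (.check l) m) = true) :
    E.test l (E.code s) (E.update (.check l) m).unpair.2 = true := by
  rwa [← show (E.update (.check l) m).unpair.1 = E.code s from h]

theorem Codes.forth {E : Enumeration T} {s t : S} {c : SearchBlock E.Label × ℕ} {a : Option Act}
    (h : E.Codes s c) (ht : T.trans s a t) :
    ∃ c' c'', E.flowchart.lts.TauSteps c c' ∧ E.flowchart.lts.trans c' a c'' ∧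
      E.Codes s c' ∧ E.Codes t c'' := by
  obtain ⟨k, ⟨htarget, htest⟩, hk⟩ :=
    ((E.frequently_test_of_trans ht).and_eventually (E.eventually_tauSteps_check h)).exists
  obtain ⟨m, hm, hupdate⟩ := hk (some (E.label a))
  have hjump : E.Jump (.check (some (E.label a)))
      (E.blockTest (.check (some (E.label a))) (E.update (.check (some (E.label a))) m)) a
      .move := by
    rw [blockTest_of_update_eq hupdate htest]
    exact .move
  exact ⟨_, (.move, E.update _ m), hm, ⟨rfl, hjump⟩, .of_update_eq hupdate,
    .of_update_eq (by rw [update, hupdate, Nat.unpair_pair, htarget])⟩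

theorem Codes.back {E : Enumeration T} {s : S} {c c' : SearchBlock E.Label × ℕ} {a : Option Act}
    (h : E.Codes s c) (hc : E.flowchart.lts.trans c a c') :
    a = none ∧ E.Codes s c' ∨ ∃ t, T.trans s a t ∧ E.Codes t c' := by
  obtain ⟨p, m⟩ := c
  obtain ⟨p', _⟩ := c'
  obtain ⟨rfl : _ = E.update p m, hjump : E.Jump p (E.blockTest p (E.update p m)) a p'⟩ := hc
  generalize htest : E.blockTest p (E.update p m) = b at hjump
  cases hjump with
  | check => exact .inl ⟨rfl, by simpa only [Codes, update, Nat.unpair_pair] using h⟩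
  | move =>
    obtain ⟨t, ht, htarget⟩ := E.exists_trans_of_test (h.test_of_blockTest htest)
    exact .inr ⟨t, ht, by simpa only [Codes, update, Nat.unpair_pair] using htarget⟩

theorem branchingBisimilar_flowchart (E : Enumeration T) :
    T.BranchingBisimilar E.flowchart.lts := by
  refine ⟨E.Codes, .of_inert_or_step ?_ ?_ ?_ ?_, ?_⟩
  · exact fun s c h a t => h.forth
  · exact fun s c h a c' => h.back
  · intro s c h hs
    obtain ⟨k, htest, hk⟩ :=
      ((E.frequently_test_of_mem_final hs).and_eventually (E.eventually_tauSteps_check h)).exists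
    obtain ⟨m, hm, hupdate⟩ := hk none
    exact ⟨_, hm, .of_update_eq hupdate, rfl, blockTest_of_update_eq hupdate htest⟩
  · rintro s ⟨p, m⟩ h ⟨rfl, htest⟩
    exact E.mem_final_of_test (h.test_of_blockTest htest)
  · exact congrArg Prod.fst (Nat.unpair_pair _ _)

end Enumeration

end Search

end ReactiveTM

/-- There is a finite set of data symbols over which every effective transition system, with
any finite set of action symbols, is branching bisimilar to the transition system of some
reactive Turing machine. -/
theorem mainTheorem2 :
    ∃ (D : Type) (_ : Finite D),
      ∀ (Act : Type*) [Finite Act] (S : Type*) (T : ReactiveTM.LTS Act S),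
        T.Effective →
          ∃ M : ReactiveTM.RTM Act D, T.BranchingBisimilar M.lts := by
  refine ⟨{x : ReactiveTM.Sym // x ≠ default}, inferInstance, fun Act _ S T hT => ?_⟩
  obtain ⟨E⟩ := hT.nonempty_enumeration
  obtain ⟨M, hM⟩ := E.flowchart.exists_branchingBisimilar_postRTM
  exact ⟨M.toRTM, (E.branchingBisimilar_flowchart.trans hM).trans M.branchingBisimilar_toRTM⟩
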